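/- Let $p,t$ be positive integers, let $X$ be a finite set partitioned into parts $X_1,\dots,X_p$ with $|X_i|=n_i$, and let $k_1,\dots,k_p$ be positive integers. Put $$\mathcal H_1=\{F\subseteq X:\ |F\cap X_i|=k_i\text{ for } i=1,\dots,p\}.$$ Assume that $n_i>2(t+1)p\,k_i^2$ for every $i$, and let $\mathcal F\subseteq\mathcal H_1$ be $t$-intersecting, i.e. $|A\cap B|\ge t$ for all $A,B\in\mathcal F$. Then $$|\mathcal F|\le \max_{\substack{t_1+\cdots+t_p=t\\ t_1,\dots,t_p\in\mathbb Z_{\ge 0}}}\ \prod_{i=1}^p\binom{n_i-t_i}{k_i-t_i},$$ where $\binom{n_i-t_i}{k_i-t_i}=0$ if $t_i>k_i$. Moreover, if $t\le k_1+\cdots+k_p$, then equality holds if and only if there is a $t$-element set $T\subseteq X$ such that $\mathcal F=\{F\in\mathcal H_1: T\subseteq F\}$ and, for every $j$ with $|T\cap X_j|\ge 1$ and every $i\in\{1,\dots,p\}$, $$\frac{k_i-|T\cap X_i|}{n_i-|T\cap X_i|}\le\frac{k_j-|T\cap X_j|+1}{n_j-|T\cap X_j|+1}.$$ -/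

import Mathlib

open Finset

/-- The ground set `X = X_1 ∪ ⋯ ∪ X_p`. -/
def groundSet {α : Type*} [DecidableEq α] {p : ℕ} (X : Fin p → Finset α) : Finset α :=
  univ.biUnion X

/-- The family of all `F ⊆ X` with `|F| = k_1 + ⋯ + k_p` and `|F ∩ X_i| = k_i` for every `i`. -/
def directProduct {α : Type*} [DecidableEq α] {p : ℕ} (X : Fin p → Finset α) (k : Fin p → ℕ) :
    Finset (Finset α) :=
  {F ∈ (groundSet X).powersetCard (∑ i, k i) | ∀ i, (F ∩ X i).card = k i}

/-- `𝓕` is `t`-intersecting: `|A ∩ B| ≥ t` for all `A, B ∈ 𝓕` (`A = B` is allowed). -/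
def IsTIntersecting {α : Type*} [DecidableEq α] (t : ℕ) (𝓕 : Finset (Finset α)) : Prop :=
  ∀ A ∈ 𝓕, ∀ B ∈ 𝓕, t ≤ (A ∩ B).card

/-- The binomial coefficient `C(n - s, k - s)` for `k ≤ n`; it is `0` when `k - s` is negative. -/
def shiftedChoose (n k s : ℕ) : ℕ :=
  if s ≤ k then (n - s).choose (k - s) else 0

/-- The maximum of `∏ i, C(n_i - s_i, k_i - s_i)` over all `s_1, …, s_p ∈ ℕ` with
`s_1 + ⋯ + s_p = t`. (For `p ≥ 1` the index set is finite and nonempty.) -/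
def maxStarSize {p : ℕ} (t : ℕ) (n k : Fin p → ℕ) : ℕ :=
  ((univ : Finset (Fin p)).piAntidiag t).sup fun s => ∏ i, shiftedChoose (n i) (k i) (s i)

/-!
Let `c` be the least size of a `t`-cover `C ⊆ X`, a set meeting every member of `𝓕` in at least `t`
elements; any member of `𝓕` is one, and `c ≥ t`. If `c = t`, then every member contains `C`, so `𝓕`
lies in a star, whose size is the product of binomial coefficients attached to the numbers
`|C ∩ X_i|` (`card_starOf_directProduct`).

If `c = t + m` with `m ≥ 1`, then `𝓕` is strictly smaller than the largest star. Each member contains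
one of the `C(t + m, t) ≤ (t + 1) ^ m` many `t`-subsets `S` of `C`. A set with fewer than `c` elements
is not a `t`-cover, so some member `B` meets it in fewer than `t` elements, and the members of `𝓕`
containing it must contain one more element of `B`. The elements of `B` in `X_i` number `k_i`, and
prescribing one of them costs a factor at most `k_i / n_i`; the assumption on `n_i` makes the total
at most `1 / (2 (t + 1))` (`sum_starWeight_insert_le`). After `m` steps (`card_starOf_le_mul_pow`) the
family has at most `(t + 1) ^ m / (2 (t + 1)) ^ m = 2 ^ (-m)` times the size of the largest star
(`subset_star_or_card_lt`).

It remains to recognise the largest stars. The condition on `T` says that moving one unit of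
`(|T ∩ X_1|, …, |T ∩ X_p|)` from one part to another does not increase the product. Since the ratios
`(k - s) / (n - s)` decrease in `s`, the product is log-concave, and such a local maximum is a global
one (`starWeight_eq_max_of_shiftRatio_le`).
-/

/-- The product `∏ i, C(n_i - s_i, k_i - s_i)`, as a rational number: the number of members of the
direct product that contain a fixed set meeting each part `X_i` in `s_i` elements. -/
def starWeight {p : ℕ} (n k s : Fin p → ℕ) : ℚ := ∏ i, (shiftedChoose (n i) (k i) (s i) : ℚ)

/-- The ratio `(k - s) / (n - s)` of consecutive shifted binomial coefficients. -/
def shiftRatio (n k s : ℕ) : ℚ := ((k : ℚ) - s) / ((n : ℚ) - s)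

/-- The subfamily of the members of `𝓕` that contain `S`. -/
def starOf {α : Type*} [DecidableEq α] (𝓕 : Finset (Finset α)) (S : Finset α) :
    Finset (Finset α) := {F ∈ 𝓕 | S ⊆ F}

/-! ### Shifted binomial coefficients -/

theorem shiftedChoose_succ_mul {n k : ℕ} (hkn : k ≤ n) (s : ℕ) :
    (shiftedChoose n k (s + 1) : ℚ) * ((n : ℚ) - s) = shiftedChoose n k s * ((k : ℚ) - s) := by
  unfold shiftedChoose
  rcases lt_trichotomy s k with h | h | h
  · rw [if_pos (by omega), if_pos h.le]
    obtain ⟨a, rfl⟩ := Nat.exists_eq_add_of_lt h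
    obtain ⟨b, rfl⟩ := Nat.exists_eq_add_of_le hkn
    have e1 : s + a + 1 + b - (s + 1) = a + b := by omega
    have e2 : s + a + 1 - (s + 1) = a := by omega
    have e3 : s + a + 1 + b - s = a + b + 1 := by omega
    have e4 : s + a + 1 - s = a + 1 := by omega
    rw [e1, e2, e3, e4]
    have := Nat.add_one_mul_choose_eq (a + b) a
    have h' : ((a : ℚ) + b + 1) * ((a + b).choose a) = ((a + b + 1).choose (a + 1)) * (a + 1) := by
      exact_mod_cast this
    push_cast
    linear_combination h'
  · subst h
    rw [if_neg (by omega)]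
    simp
  · rw [if_neg (by omega), if_neg (by omega)]
    simp

theorem shiftedChoose_succ_mul_le {n k : ℕ} (hkn : k ≤ n) (s : ℕ) :
    (shiftedChoose n k (s + 1) : ℚ) * n ≤ shiftedChoose n k s * k := by
  by_cases h : s < k
  · have h1 := shiftedChoose_succ_mul hkn s
    have hsk : (s : ℚ) < k := by exact_mod_cast h
    have hkn' : (k : ℚ) ≤ n := by exact_mod_cast hkn
    have h0 : (0 : ℚ) ≤ shiftedChoose n k s := by positivity
    have hs : (0 : ℚ) ≤ s := by positivity
    have hpos : (0 : ℚ) < n - s := by linarith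
    refine le_of_mul_le_mul_right ?_ hpos
    calc (shiftedChoose n k (s + 1) : ℚ) * n * (n - s)
        = shiftedChoose n k s * (n * (k - s)) := by linear_combination (n : ℚ) * h1
      _ ≤ shiftedChoose n k s * (k * (n - s)) := by
          refine mul_le_mul_of_nonneg_left ?_ h0
          nlinarith
      _ = _ := by ring
  · have : shiftedChoose n k (s + 1) = 0 := by
      unfold shiftedChoose
      rw [if_neg (by omega)]
    rw [this]
    simp only [Nat.cast_zero, zero_mul]
    positivity

theorem shiftedChoose_pos {n k s : ℕ} (hkn : k ≤ n) : 0 < shiftedChoose n k s ↔ s ≤ k := by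
  unfold shiftedChoose
  split_ifs with h
  · simpa [h] using Nat.choose_pos (by omega)
  · simpa using h

theorem shiftedChoose_succ {n k s : ℕ} (hkn : k ≤ n) (hs : s < n) :
    (shiftedChoose n k (s + 1) : ℚ) = shiftedChoose n k s * shiftRatio n k s := by
  have h : (0 : ℚ) < n - s := by
    have : (s : ℚ) < n := by exact_mod_cast hs
    linarith
  unfold shiftRatio
  rw [← mul_div_assoc, eq_div_iff h.ne', shiftedChoose_succ_mul hkn]

theorem shiftRatio_anti {n k a b : ℕ} (hkn : k ≤ n) (hab : a ≤ b) (hb : b < n) :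
    shiftRatio n k b ≤ shiftRatio n k a := by
  have h1 : (k : ℚ) ≤ n := by exact_mod_cast hkn
  have h2 : (a : ℚ) ≤ b := by exact_mod_cast hab
  have h3 : (b : ℚ) < n := by exact_mod_cast hb
  unfold shiftRatio
  rw [div_le_div_iff₀ (by linarith) (by linarith)]
  nlinarith

/-- Log-concavity against a threshold: if `l` separates the ratios before and after `s`, then moving
from `s` to `s'` gains at most the factor `l ^ (s' - s)`. The powers are put on both sides so that
neither direction needs a division. -/
theorem shiftedChoose_mul_pow_le {n k s s' : ℕ} {l : ℚ} (hkn : k ≤ n) (hl : 0 ≤ l) (hs : s ≤ k)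
    (hsn : s < n) (hsn' : s' < n) (hup : shiftRatio n k s ≤ l)
    (hdown : 1 ≤ s → l ≤ shiftRatio n k (s - 1)) :
    (shiftedChoose n k s' : ℚ) * l ^ s ≤ shiftedChoose n k s * l ^ s' := by
  rcases le_total s s' with h | h
  · obtain ⟨d, rfl⟩ := Nat.exists_eq_add_of_le h
    rw [pow_add, mul_comm (l ^ s), ← mul_assoc]
    refine mul_le_mul_of_nonneg_right ?_ (pow_nonneg hl s)
    clear h
    induction d with
    | zero => simp
    | succ d ih =>
      have hlt : s + d < n := by omega
      rw [← add_assoc, shiftedChoose_succ hkn hlt, pow_succ, ← mul_assoc]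
      have h1 : shiftRatio n k (s + d) ≤ l := (shiftRatio_anti hkn (by omega) hlt).trans hup
      calc _ ≤ (shiftedChoose n k (s + d) : ℚ) * l :=
            mul_le_mul_of_nonneg_left h1 (by positivity)
        _ ≤ _ := mul_le_mul_of_nonneg_right (ih hlt) hl
  · obtain ⟨d, rfl⟩ := Nat.exists_eq_add_of_le h
    rw [pow_add, mul_comm (l ^ s'), ← mul_assoc]
    refine mul_le_mul_of_nonneg_right ?_ (pow_nonneg hl s')
    have key : ∀ e ≤ d, (shiftedChoose n k s' : ℚ) * l ^ e ≤ shiftedChoose n k (s' + e) := by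
      intro e
      induction e with
      | zero => simp
      | succ e ih =>
        intro he
        have hlt : s' + e < n := by omega
        rw [← add_assoc, shiftedChoose_succ hkn hlt, pow_succ, ← mul_assoc]
        have h1 : l ≤ shiftRatio n k (s' + e) :=
          (hdown (by omega)).trans (shiftRatio_anti hkn (by omega) (by omega))
        calc _ ≤ (shiftedChoose n k (s' + e) : ℚ) * l :=
              mul_le_mul_of_nonneg_right (ih (by omega)) hl
          _ ≤ _ := mul_le_mul_of_nonneg_left h1 (by positivity)
    exact key d le_rfl

/-! ### Star weights -/

section Weight

variable {p : ℕ} {n k : Fin p → ℕ}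

theorem starWeight_nonneg (s : Fin p → ℕ) : 0 ≤ starWeight n k s :=
  prod_nonneg fun _ _ => Nat.cast_nonneg _

theorem starWeight_pos (hkn : ∀ i, k i ≤ n i) (s : Fin p → ℕ) :
    0 < starWeight n k s ↔ ∀ i, s i ≤ k i := by
  rw [(starWeight_nonneg s).lt_iff_ne', starWeight, prod_ne_zero_iff]
  refine ⟨fun h i => ?_, fun h i _ => ?_⟩
  · rw [← shiftedChoose_pos (hkn i)]
    exact Nat.pos_of_ne_zero fun h0 => h i (mem_univ i) (by simp [h0])
  · exact_mod_cast ((shiftedChoose_pos (hkn i)).2 (h i)).ne'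

theorem starWeight_add_single (s : Fin p → ℕ) (i : Fin p) :
    starWeight n k (s + Pi.single i 1) = shiftedChoose (n i) (k i) (s i + 1) *
      ∏ j ∈ univ.erase i, (shiftedChoose (n j) (k j) (s j) : ℚ) := by
  rw [starWeight, ← mul_prod_erase univ _ (mem_univ i)]
  congr 1
  · simp
  · refine prod_congr rfl fun j hj => ?_
    simp [Pi.single_eq_of_ne (ne_of_mem_erase hj)]

theorem starWeight_eq_mul_erase (s : Fin p → ℕ) (i : Fin p) :
    starWeight n k s = shiftedChoose (n i) (k i) (s i) *
      ∏ j ∈ univ.erase i, (shiftedChoose (n j) (k j) (s j) : ℚ) :=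
  (mul_prod_erase univ _ (mem_univ i)).symm

theorem starWeight_add_single_eq (hkn : ∀ i, k i ≤ n i) (s : Fin p → ℕ) {i : Fin p}
    (hs : s i < n i) :
    starWeight n k (s + Pi.single i 1) = starWeight n k s * shiftRatio (n i) (k i) (s i) := by
  rw [starWeight_add_single, starWeight_eq_mul_erase s i, shiftedChoose_succ (hkn i) hs]
  ring

theorem starWeight_add_single_le (hkn : ∀ i, k i ≤ n i) (hn : ∀ i, 0 < n i) (s : Fin p → ℕ)
    (i : Fin p) : starWeight n k (s + Pi.single i 1) ≤ starWeight n k s * (k i / n i) := by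
  have hpos : (0 : ℚ) < n i := by exact_mod_cast hn i
  rw [starWeight_add_single, starWeight_eq_mul_erase s i, ← mul_div_assoc, le_div_iff₀ hpos]
  have h0 : (0 : ℚ) ≤ ∏ j ∈ univ.erase i, (shiftedChoose (n j) (k j) (s j) : ℚ) :=
    prod_nonneg fun _ _ => Nat.cast_nonneg _
  nlinarith [mul_le_mul_of_nonneg_right (shiftedChoose_succ_mul_le (hkn i) (s i)) h0]

theorem starWeight_le_maxStarSize {t : ℕ} {s : Fin p → ℕ} (hs : ∑ i, s i = t) :
    starWeight n k s ≤ maxStarSize t n k := by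
  have : ∏ i, shiftedChoose (n i) (k i) (s i) ≤ maxStarSize t n k :=
    le_sup (f := fun s : Fin p → ℕ => ∏ i, shiftedChoose (n i) (k i) (s i)) (by simp [hs])
  unfold starWeight
  exact_mod_cast this

theorem maxStarSize_le_starWeight {t : ℕ} {s : Fin p → ℕ}
    (h : ∀ s' : Fin p → ℕ, ∑ i, s' i = t → starWeight n k s' ≤ starWeight n k s) :
    (maxStarSize t n k : ℚ) ≤ starWeight n k s := by
  have : maxStarSize t n k ≤ ∏ i, shiftedChoose (n i) (k i) (s i) := by
    refine Finset.sup_le fun s' hs' => ?_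
    have := h s' (mem_piAntidiag.1 hs').1
    unfold starWeight at this
    exact_mod_cast this
  unfold starWeight
  exact_mod_cast this

theorem exists_le_sum_eq {t : ℕ} (ht : t ≤ ∑ i, k i) :
    ∃ s : Fin p → ℕ, (∀ i, s i ≤ k i) ∧ ∑ i, s i = t := by
  induction t with
  | zero => exact ⟨0, by simp, by simp⟩
  | succ t ih =>
    obtain ⟨s, hs, hst⟩ := ih (by omega)
    obtain ⟨i, -, hi⟩ := exists_lt_of_sum_lt (s := univ) (f := s) (g := k) (by omega)
    refine ⟨s + Pi.single i 1, fun j => ?_, ?_⟩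
    · by_cases hj : j = i
      · subst hj
        simpa using hi
      · simpa [Pi.single_eq_of_ne hj] using hs j
    · simp [sum_add_distrib, hst]

theorem maxStarSize_pos {t : ℕ} (hkn : ∀ i, k i ≤ n i) (ht : t ≤ ∑ i, k i) :
    0 < maxStarSize t n k := by
  obtain ⟨s, hs, hst⟩ := exists_le_sum_eq ht
  have := ((starWeight_pos hkn s).2 hs).trans_le (starWeight_le_maxStarSize hst)
  exact_mod_cast this

/-- A maximiser of the star weight cannot be improved by moving one unit from a part `j` to a
part `i`. -/
theorem shiftRatio_le_of_starWeight_eq_max {t : ℕ} (hkn : ∀ i, k i ≤ n i) (htn : ∀ i, t < n i)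
    (htk : t ≤ ∑ i, k i) {s : Fin p → ℕ} (hs : ∑ i, s i = t)
    (hmax : starWeight n k s = maxStarSize t n k) {j : Fin p} (hj : 1 ≤ s j) (i : Fin p) :
    shiftRatio (n i) (k i) (s i) ≤ shiftRatio (n j) (k j) (s j - 1) := by
  have hsn : ∀ i, s i < n i := fun i =>
    ((single_le_sum (fun _ _ => Nat.zero_le _) (mem_univ i)).trans hs.le).trans_lt (htn i)
  by_cases hij : i = j
  · subst hij
    exact shiftRatio_anti (hkn i) (by omega) (hsn i)
  obtain ⟨u, hu⟩ : ∃ u : Fin p → ℕ, s = u + Pi.single j 1 := by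
    refine ⟨s - Pi.single j 1, (tsub_add_cancel_of_le fun l => ?_).symm⟩
    by_cases hl : l = j
    · subst hl
      simpa using hj
    · simp [Pi.single_eq_of_ne hl]
  have huj : u j = s j - 1 := by simp [hu]
  have hui : u i = s i := by simp [hu, Pi.single_eq_of_ne hij]
  have hsum : ∑ l, (u + Pi.single i 1 : Fin p → ℕ) l = t := by
    rw [← hs, hu]
    simp [sum_add_distrib]
  have hle : starWeight n k (u + Pi.single i 1) ≤ starWeight n k (u + Pi.single j 1) := by
    rw [← hu, hmax]
    exact starWeight_le_maxStarSize hsum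
  have hpos : 0 < starWeight n k s := by
    rw [hmax]
    exact_mod_cast maxStarSize_pos hkn htk
  have hupos : 0 < starWeight n k u := by
    rw [starWeight_pos hkn] at hpos ⊢
    intro l
    refine le_trans ?_ (hpos l)
    rw [hu]
    simp
  rw [starWeight_add_single_eq hkn u (by rw [hui]; exact hsn i),
    starWeight_add_single_eq hkn u (by have := hsn j; omega), hui, huj] at hle
  exact le_of_mul_le_mul_left hle hupos

/-- Local optimality under moving one unit implies global optimality. The threshold is the least
ratio `(k_j - s_j + 1) / (n_j - s_j + 1)` over the parts with `s_j ≥ 1`; it separates all ratios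
already used from all ratios still available, so `shiftedChoose_mul_pow_le` applies in each
part. -/
theorem starWeight_eq_max_of_shiftRatio_le {t : ℕ} (ht : 0 < t) (hkn : ∀ i, k i ≤ n i)
    (htn : ∀ i, t < n i) (htk : t ≤ ∑ i, k i) {s : Fin p → ℕ} (hs : ∑ i, s i = t)
    (hloc : ∀ j, 1 ≤ s j → ∀ i,
      shiftRatio (n i) (k i) (s i) ≤ shiftRatio (n j) (k j) (s j - 1)) :
    starWeight n k s = maxStarSize t n k := by
  have hlt : ∀ s' : Fin p → ℕ, ∑ i, s' i = t → ∀ i, s' i < n i := fun s' hs' i =>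
    ((single_le_sum (fun _ _ => Nat.zero_le _) (mem_univ i)).trans hs'.le).trans_lt (htn i)
  have hsn := hlt s hs
  have hsn' : ∀ i, (0 : ℚ) < n i - s i := fun i => by
    have : (s i : ℚ) < n i := by exact_mod_cast hsn i
    linarith
  -- If some `s_j` exceeded `k_j`, all ratios would be nonpositive, so `t = ∑ s_i > ∑ k_i`.
  have hsk : ∀ i, s i ≤ k i := by
    by_contra! hcon
    obtain ⟨j, hj⟩ := hcon
    have hall : ∀ i, k i ≤ s i := by
      intro i
      have h1 := hloc j (by omega) i
      have h2 : shiftRatio (n j) (k j) (s j - 1) ≤ 0 := by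
        have a1 : (k j : ℚ) ≤ (s j - 1 : ℕ) := by exact_mod_cast (by omega : k j ≤ s j - 1)
        have a2 : ((s j - 1 : ℕ) : ℚ) ≤ n j := by
          have := hsn j
          exact_mod_cast (by omega : s j - 1 ≤ n j)
        exact div_nonpos_of_nonpos_of_nonneg (by linarith) (by linarith)
      have h3 := h1.trans h2
      unfold shiftRatio at h3
      rw [div_le_iff₀ (hsn' i), zero_mul] at h3
      have : (k i : ℚ) ≤ s i := by linarith
      exact_mod_cast this
    have := sum_lt_sum (s := univ) (fun i _ => hall i) ⟨j, mem_univ j, hj⟩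
    omega
  obtain ⟨j, hj, hmin⟩ : ∃ j, 1 ≤ s j ∧ ∀ i, 1 ≤ s i →
      shiftRatio (n j) (k j) (s j - 1) ≤ shiftRatio (n i) (k i) (s i - 1) := by
    have hne : (univ.filter fun j => 1 ≤ s j).Nonempty := by
      by_contra hcon
      rw [not_nonempty_iff_eq_empty, filter_eq_empty_iff] at hcon
      have : ∑ i, s i = 0 := sum_eq_zero fun i hi => by have := hcon hi; omega
      omega
    obtain ⟨j, hj, hmin⟩ := exists_min_image _
      (fun j => shiftRatio (n j) (k j) (s j - 1)) hne
    exact ⟨j, (mem_filter.1 hj).2, fun i hi => hmin i (by simp [hi])⟩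
  set l := shiftRatio (n j) (k j) (s j - 1) with hl
  have hlpos : 0 < l := by
    have a1 : ((s j - 1 : ℕ) : ℚ) < k j := by
      have := hsk j
      exact_mod_cast (by omega : s j - 1 < k j)
    have a2 : (k j : ℚ) ≤ n j := by exact_mod_cast hkn j
    exact div_pos (by linarith) (by linarith)
  refine le_antisymm (starWeight_le_maxStarSize hs) (maxStarSize_le_starWeight fun s' hs' => ?_)
  have h := prod_le_prod (s := univ)
    (f := fun i => (shiftedChoose (n i) (k i) (s' i) : ℚ) * l ^ s i)
    (g := fun i => (shiftedChoose (n i) (k i) (s i) : ℚ) * l ^ s' i)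
    (fun i _ => by positivity)
    fun i _ => shiftedChoose_mul_pow_le (hkn i) hlpos.le (hsk i) (hsn i) (hlt s' hs' i)
      (hloc j hj i) (hmin i)
  rw [prod_mul_distrib, prod_mul_distrib, prod_pow_eq_pow_sum, prod_pow_eq_pow_sum, hs, hs'] at h
  exact le_of_mul_le_mul_right h (pow_pos hlpos t)

end Weight

/-! ### Counting members that contain a given set -/

section Counting

variable {α : Type*} [DecidableEq α] {p : ℕ} {X : Fin p → Finset α} {n k : Fin p → ℕ}

theorem biUnion_inter_part {S : Finset α} (hS : S ⊆ groundSet X) :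
    univ.biUnion (fun i => S ∩ X i) = S := by
  rw [← inter_biUnion]
  exact inter_eq_left.2 hS

theorem biUnion_inter_eq_of_subset (hdisj : ∀ i j, i ≠ j → Disjoint (X i) (X j))
    {g : Fin p → Finset α} (hg : ∀ i, g i ⊆ X i) (i : Fin p) :
    univ.biUnion g ∩ X i = g i := by
  ext x
  simp only [mem_inter, mem_biUnion, mem_univ, true_and]
  refine ⟨?_, fun h => ⟨⟨i, h⟩, hg i h⟩⟩
  rintro ⟨⟨j, hj⟩, hi⟩
  by_cases hij : j = i
  · exact hij ▸ hj
  · exact absurd hi (disjoint_left.1 (hdisj j i hij) (hg j hj))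

theorem sum_card_inter_part (hdisj : ∀ i j, i ≠ j → Disjoint (X i) (X j))
    {S : Finset α} (hS : S ⊆ groundSet X) : ∑ i, (S ∩ X i).card = S.card := by
  rw [← card_biUnion fun i _ j _ hij => (hdisj i j hij).mono inter_subset_right inter_subset_right,
    biUnion_inter_part hS]

theorem mem_directProduct (hdisj : ∀ i j, i ≠ j → Disjoint (X i) (X j)) {F : Finset α} :
    F ∈ directProduct X k ↔ F ⊆ groundSet X ∧ ∀ i, (F ∩ X i).card = k i := by
  simp only [directProduct, mem_filter, mem_powersetCard]
  refine ⟨fun h => ⟨h.1.1, h.2⟩, fun h => ⟨⟨h.1, ?_⟩, h.2⟩⟩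
  rw [← sum_card_inter_part hdisj h.1]
  exact sum_congr rfl fun i _ => h.2 i

theorem card_filter_subset_powersetCard {Y R : Finset α} (hR : R ⊆ Y) (r : ℕ) :
    ({G ∈ Y.powersetCard r | R ⊆ G}).card = shiftedChoose Y.card r R.card := by
  unfold shiftedChoose
  split_ifs with h
  · exact card_filter_powersetCard_subset R Y r hR h
  · rw [card_eq_zero, filter_eq_empty_iff]
    intro G hG hRG
    have := card_le_card hRG
    rw [(mem_powersetCard.1 hG).2] at this
    exact h this

theorem card_starOf_directProduct (hdisj : ∀ i j, i ≠ j → Disjoint (X i) (X j))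
    (hcard : ∀ i, (X i).card = n i) {S : Finset α} (hS : S ⊆ groundSet X) :
    ((starOf (directProduct X k) S).card : ℚ) = starWeight n k fun i => (S ∩ X i).card := by
  have h : (starOf (directProduct X k) S).card =
      (Fintype.piFinset fun i => {G ∈ (X i).powersetCard (k i) | S ∩ X i ⊆ G}).card := by
    refine card_bij' (fun F _ i => F ∩ X i) (fun g _ => univ.biUnion g) ?_ ?_ ?_ ?_
    · intro F hF
      obtain ⟨hF, hSF⟩ := mem_filter.1 hF
      obtain ⟨-, hFk⟩ := (mem_directProduct hdisj).1 hF
      rw [Fintype.mem_piFinset]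
      exact fun i => mem_filter.2 ⟨mem_powersetCard.2 ⟨inter_subset_right, hFk i⟩,
        inter_subset_inter_right hSF⟩
    · intro g hg
      rw [Fintype.mem_piFinset] at hg
      simp only [mem_filter, mem_powersetCard] at hg
      refine mem_filter.2 ⟨(mem_directProduct hdisj).2 ⟨?_, fun i => ?_⟩, ?_⟩
      · exact biUnion_mono fun i _ => (hg i).1.1
      · rw [biUnion_inter_eq_of_subset hdisj fun i => (hg i).1.1]
        exact (hg i).1.2
      · rw [← biUnion_inter_part hS]
        exact biUnion_mono fun i _ => (hg i).2
    · intro F hF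
      exact biUnion_inter_part ((mem_directProduct hdisj).1 (mem_filter.1 hF).1).1
    · intro g hg
      rw [Fintype.mem_piFinset] at hg
      simp only [mem_filter, mem_powersetCard] at hg
      funext i
      exact biUnion_inter_eq_of_subset hdisj (fun i => (hg i).1.1) i
  rw [h, Fintype.card_piFinset, starWeight]
  push_cast
  refine prod_congr rfl fun i _ => ?_
  rw [card_filter_subset_powersetCard inter_subset_right, hcard]

theorem card_starOf_le_starWeight (hdisj : ∀ i j, i ≠ j → Disjoint (X i) (X j))
    (hcard : ∀ i, (X i).card = n i) {𝓕 : Finset (Finset α)} (hsub : 𝓕 ⊆ directProduct X k)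
    {S : Finset α} (hS : S ⊆ groundSet X) :
    ((starOf 𝓕 S).card : ℚ) ≤ starWeight n k fun i => (S ∩ X i).card := by
  rw [← card_starOf_directProduct hdisj hcard hS]
  exact_mod_cast card_le_card (filter_subset_filter _ hsub)

theorem card_insert_inter_part (hdisj : ∀ i j, i ≠ j → Disjoint (X i) (X j)) {S : Finset α}
    {i : Fin p} {y : α} (hy : y ∈ X i) (hyS : y ∉ S) :
    (fun l => (insert y S ∩ X l).card) = (fun l => (S ∩ X l).card) + Pi.single i 1 := by
  funext l
  by_cases hl : l = i
  · subst hl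
    rw [insert_inter_of_mem hy, card_insert_of_notMem fun h => hyS (mem_inter.1 h).1]
    simp
  · rw [insert_inter_of_notMem fun h => disjoint_left.1 (hdisj l i hl) h hy]
    simp [Pi.single_eq_of_ne hl]

/-! ### Branching on a minimal cover -/

/-- One branching step: the weights of the sets obtained from `S` by adding one element of a
fixed member `B` sum to at most a `1 / (2 (t + 1))` fraction of the weight of `S`. Part `i` offers at
most `k_i` elements, each costing a factor `k_i / n_i < 1 / (2 (t + 1) p k_i)`. -/
theorem sum_starWeight_insert_le {t : ℕ} (hp : 0 < p) (hkn : ∀ i, k i ≤ n i)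
    (hn : ∀ i, 2 * (t + 1) * p * k i ^ 2 < n i)
    (hdisj : ∀ i j, i ≠ j → Disjoint (X i) (X j)) {B : Finset α} (hB : B ∈ directProduct X k)
    (S : Finset α) :
    ∑ y ∈ B \ S, starWeight n k (fun i => (insert y S ∩ X i).card) ≤
      starWeight n k (fun i => (S ∩ X i).card) * (1 / (2 * ((t : ℚ) + 1))) := by
  obtain ⟨hBX, hBk⟩ := (mem_directProduct hdisj).1 hB
  set w := starWeight n k fun i => (S ∩ X i).card with hw
  have hw0 : 0 ≤ w := starWeight_nonneg _
  have hpQ : (0 : ℚ) < p := by exact_mod_cast hp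
  have hBS : B \ S ⊆ groundSet X := sdiff_subset.trans hBX
  have hpart : ∀ i, ∑ y ∈ (B \ S) ∩ X i, starWeight n k (fun l => (insert y S ∩ X l).card) ≤
      w * (1 / (2 * ((t : ℚ) + 1) * p)) := by
    intro i
    have hni : (0 : ℚ) < n i := by
      have := hn i
      exact_mod_cast (by omega : 0 < n i)
    have hc : (((B \ S) ∩ X i).card : ℚ) ≤ k i := by
      rw [← hBk i]
      exact_mod_cast card_le_card (inter_subset_inter_right sdiff_subset)
    have hterm : ∀ y ∈ (B \ S) ∩ X i,
        starWeight n k (fun l => (insert y S ∩ X l).card) ≤ w * (k i / n i) := by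
      intro y hy
      obtain ⟨hy1, hyX⟩ := mem_inter.1 hy
      rw [card_insert_inter_part hdisj hyX (mem_sdiff.1 hy1).2]
      exact starWeight_add_single_le hkn (fun i => by have := hn i; omega) _ i
    refine (sum_le_card_nsmul _ _ _ hterm).trans ?_
    rw [nsmul_eq_mul]
    have h2 : (k i : ℚ) * (k i / n i) ≤ 1 / (2 * ((t : ℚ) + 1) * p) := by
      rw [← mul_div_assoc, div_le_div_iff₀ hni (by positivity)]
      have : (2 * ((t : ℚ) + 1) * p * k i ^ 2) < n i := by exact_mod_cast hn i
      nlinarith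
    calc _ ≤ (k i : ℚ) * (w * (k i / n i)) :=
          mul_le_mul_of_nonneg_right hc (by positivity)
      _ = w * (k i * (k i / n i)) := by ring
      _ ≤ _ := mul_le_mul_of_nonneg_left h2 hw0
  calc ∑ y ∈ B \ S, starWeight n k (fun i => (insert y S ∩ X i).card)
      = ∑ i, ∑ y ∈ (B \ S) ∩ X i, starWeight n k (fun l => (insert y S ∩ X l).card) := by
        rw [← sum_biUnion fun i _ j _ hij =>
          (hdisj i j hij).mono inter_subset_right inter_subset_right, biUnion_inter_part hBS]
    _ ≤ ∑ _i : Fin p, w * (1 / (2 * ((t : ℚ) + 1) * p)) := sum_le_sum fun i _ => hpart i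
    _ = w * (1 / (2 * ((t : ℚ) + 1))) := by
        rw [sum_const, card_univ, Fintype.card_fin, nsmul_eq_mul]
        field_simp

/-- `S` is a `t`-cover of `𝓕`: it meets every member in at least `t` elements. -/
def IsTCover (t : ℕ) (𝓕 : Finset (Finset α)) (S : Finset α) : Prop :=
  ∀ F ∈ 𝓕, t ≤ (S ∩ F).card

/-- As long as `S` is too small to be a `t`-cover, some member `B` meets it in fewer than `t`
elements, so every member containing `S` contains a further element of `B`. Iterating this `d`
times gains the factor of `sum_starWeight_insert_le` each time. -/
theorem card_starOf_le_mul_pow {t : ℕ} (hp : 0 < p) (hkn : ∀ i, k i ≤ n i)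
    (hn : ∀ i, 2 * (t + 1) * p * k i ^ 2 < n i)
    (hdisj : ∀ i j, i ≠ j → Disjoint (X i) (X j)) (hcard : ∀ i, (X i).card = n i)
    {𝓕 : Finset (Finset α)} (hsub : 𝓕 ⊆ directProduct X k) (hint : IsTIntersecting t 𝓕) {c : ℕ}
    (hc : ∀ S ⊆ groundSet X, IsTCover t 𝓕 S → c ≤ S.card) (d : ℕ) :
    ∀ S ⊆ groundSet X, S.card + d ≤ c →
      ((starOf 𝓕 S).card : ℚ) ≤
        starWeight n k (fun i => (S ∩ X i).card) * (1 / (2 * ((t : ℚ) + 1))) ^ d := by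
  induction d with
  | zero =>
    intro S hS _
    simpa using card_starOf_le_starWeight hdisj hcard hsub hS
  | succ d ih =>
    intro S hS hSc
    have hnot : ¬ IsTCover t 𝓕 S := fun h => by
      have := hc S hS h
      omega
    simp only [IsTCover, not_forall, not_le] at hnot
    obtain ⟨B, hB, hSB⟩ := hnot
    have hBX := ((mem_directProduct hdisj).1 (hsub hB)).1
    have hcov : starOf 𝓕 S ⊆ (B \ S).biUnion fun y => starOf 𝓕 (insert y S) := by
      intro F hF
      obtain ⟨hF, hSF⟩ := mem_filter.1 hF
      obtain ⟨y, hy, hyS⟩ := exists_mem_notMem_of_card_lt_card (hSB.trans_le (hint F hF B hB))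
      obtain ⟨hyF, hyB⟩ := mem_inter.1 hy
      refine mem_biUnion.2 ⟨y, mem_sdiff.2 ⟨hyB, fun h => hyS (mem_inter.2 ⟨h, hyB⟩)⟩, ?_⟩
      exact mem_filter.2 ⟨hF, insert_subset hyF hSF⟩
    have h1 : ((starOf 𝓕 S).card : ℚ) ≤ ∑ y ∈ B \ S, ((starOf 𝓕 (insert y S)).card : ℚ) := by
      exact_mod_cast (card_le_card hcov).trans card_biUnion_le
    calc _ ≤ _ := h1
      _ ≤ ∑ y ∈ B \ S, starWeight n k (fun i => (insert y S ∩ X i).card) *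
            (1 / (2 * ((t : ℚ) + 1))) ^ d := by
          refine sum_le_sum fun y hy => ?_
          obtain ⟨hyB, hyS⟩ := mem_sdiff.1 hy
          refine ih _ (insert_subset (hBX hyB) hS) ?_
          rw [card_insert_of_notMem hyS]
          omega
      _ ≤ _ := by
          rw [← sum_mul, pow_succ', ← mul_assoc]
          exact mul_le_mul_of_nonneg_right (sum_starWeight_insert_le hp hkn hn hdisj (hsub hB) S)
            (by positivity)

theorem choose_add_le_pow (t m : ℕ) : (t + m).choose t ≤ (t + 1) ^ m := by
  induction m with
  | zero => simp
  | succ m ih =>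
    have h := Nat.choose_mul_succ_eq (t + m) t
    have e : t + m + 1 - t = m + 1 := by omega
    rw [e] at h
    have h2 : (t + (m + 1)).choose t * (m + 1) ≤ (t + 1) ^ (m + 1) * (m + 1) := by
      rw [← add_assoc, ← h, pow_succ, mul_assoc]
      refine Nat.mul_le_mul ih ?_
      nlinarith [Nat.zero_le (t * m)]
    exact Nat.le_of_mul_le_mul_right h2 (by omega)

/-- A nonempty `t`-intersecting family either consists of members containing a common `t`-set, or is
strictly smaller than the largest star. -/
theorem subset_star_or_card_lt {t : ℕ} (hp : 0 < p) (hkn : ∀ i, k i ≤ n i)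
    (hn : ∀ i, 2 * (t + 1) * p * k i ^ 2 < n i)
    (hdisj : ∀ i j, i ≠ j → Disjoint (X i) (X j)) (hcard : ∀ i, (X i).card = n i)
    {𝓕 : Finset (Finset α)} (hsub : 𝓕 ⊆ directProduct X k) (hint : IsTIntersecting t 𝓕)
    (hne : 𝓕.Nonempty) :
    (∃ T ⊆ groundSet X, T.card = t ∧ 𝓕 ⊆ starOf (directProduct X k) T) ∨
      𝓕.card < maxStarSize t n k := by
  classical
  obtain ⟨A, hA⟩ := hne
  obtain ⟨hAX, hAk⟩ := (mem_directProduct hdisj).1 (hsub hA)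
  obtain ⟨C, hC, hmin⟩ := exists_min_image
    ((groundSet X).powerset.filter (IsTCover t 𝓕)) Finset.card
    ⟨A, mem_filter.2 ⟨mem_powerset.2 hAX, fun F hF => hint A hA F hF⟩⟩
  obtain ⟨hCX, hCcov⟩ := mem_filter.1 hC
  rw [mem_powerset] at hCX
  have hc : ∀ S ⊆ groundSet X, IsTCover t 𝓕 S → C.card ≤ S.card := fun S hS h =>
    hmin S (mem_filter.2 ⟨mem_powerset.2 hS, h⟩)
  obtain ⟨m, hm⟩ := Nat.exists_eq_add_of_le
    ((hCcov A hA).trans (card_le_card (inter_subset_left (s₁ := C) (s₂ := A))))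
  rcases Nat.eq_zero_or_pos m with rfl | hmpos
  · refine Or.inl ⟨C, hCX, hm, fun F hF => mem_filter.2 ⟨hsub hF, ?_⟩⟩
    have h1 : C ∩ F = C := eq_of_subset_of_card_le inter_subset_left (by
      have := hCcov F hF
      omega)
    exact inter_eq_left.1 h1
  · right
    have htk : t ≤ ∑ i, k i := by
      have h1 := hint A hA A hA
      rw [inter_self, ← sum_card_inter_part hdisj hAX] at h1
      exact h1.trans (sum_le_sum fun i _ => (hAk i).le)
    set M : ℚ := ((maxStarSize t n k : ℕ) : ℚ) with hM
    have hMpos : 0 < M := by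
      rw [hM]
      exact_mod_cast maxStarSize_pos hkn htk
    have hcov : 𝓕 ⊆ (C.powersetCard t).biUnion fun S => starOf 𝓕 S := by
      intro F hF
      obtain ⟨S, hS, hSt⟩ := exists_subset_card_eq (hCcov F hF)
      exact mem_biUnion.2 ⟨S, mem_powersetCard.2 ⟨hS.trans inter_subset_left, hSt⟩,
        mem_filter.2 ⟨hF, hS.trans inter_subset_right⟩⟩
    have h1 : (𝓕.card : ℚ) ≤ ∑ S ∈ C.powersetCard t, ((starOf 𝓕 S).card : ℚ) := by
      exact_mod_cast (card_le_card hcov).trans card_biUnion_le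
    have h2 : ∀ S ∈ C.powersetCard t,
        ((starOf 𝓕 S).card : ℚ) ≤ M * (1 / (2 * ((t : ℚ) + 1))) ^ m := by
      intro S hS
      obtain ⟨hSC, hSt⟩ := mem_powersetCard.1 hS
      have hSX := hSC.trans hCX
      refine (card_starOf_le_mul_pow hp hkn hn hdisj hcard hsub hint hc m S hSX
        (by omega)).trans ?_
      refine mul_le_mul_of_nonneg_right (starWeight_le_maxStarSize ?_) (by positivity)
      rw [sum_card_inter_part hdisj hSX, hSt]
    have h3 : (𝓕.card : ℚ) < M := by
      have hch : ((t + m).choose t : ℚ) ≤ ((t : ℚ) + 1) ^ m := by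
        exact_mod_cast choose_add_le_pow t m
      calc (𝓕.card : ℚ) ≤ _ := h1
        _ ≤ (t + m).choose t * (M * (1 / (2 * ((t : ℚ) + 1))) ^ m) := by
            refine (sum_le_card_nsmul _ _ _ h2).trans ?_
            rw [card_powersetCard, hm, nsmul_eq_mul]
        _ ≤ ((t : ℚ) + 1) ^ m * (M * (1 / (2 * ((t : ℚ) + 1))) ^ m) :=
            mul_le_mul_of_nonneg_right hch (by positivity)
        _ = M * (1 / 2) ^ m := by
            rw [mul_left_comm, ← mul_pow]
            congr 2
            field_simp
        _ < M := mul_lt_of_lt_one_right hMpos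
            (pow_lt_one₀ (by norm_num) (by norm_num) (by omega))
    rw [hM] at h3
    exact_mod_cast h3

end Counting

/-! ### The largest intersecting families -/

theorem theorem1p2 {α : Type*} [DecidableEq α] (p t : ℕ) (hp : 0 < p) (ht : 0 < t)
    (n k : Fin p → ℕ) (hk : ∀ i, 0 < k i)
    (X : Fin p → Finset α) (hdisj : ∀ i j, i ≠ j → Disjoint (X i) (X j))
    (hcard : ∀ i, (X i).card = n i)
    (hn : ∀ i, 2 * (t + 1) * p * k i ^ 2 < n i)
    (𝓕 : Finset (Finset α)) (hsub : 𝓕 ⊆ directProduct X k) (hint : IsTIntersecting t 𝓕) :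
    𝓕.card ≤ maxStarSize t n k ∧
    (t ≤ ∑ i, k i →
      (𝓕.card = maxStarSize t n k ↔
        ∃ T : Finset α, T ⊆ groundSet X ∧ T.card = t ∧
          (∀ j, 1 ≤ (T ∩ X j).card → ∀ i,
            ((k i : ℚ) - (T ∩ X i).card) / ((n i : ℚ) - (T ∩ X i).card) ≤
              ((k j : ℚ) - (T ∩ X j).card + 1) / ((n j : ℚ) - (T ∩ X j).card + 1)) ∧
          𝓕 = {F ∈ directProduct X k | T ⊆ F})) := by
  have hkn : ∀ i, k i ≤ n i := fun i => by
    have h1 : k i ^ 2 ≤ 2 * (t + 1) * p * k i ^ 2 := Nat.le_mul_of_pos_left _ (by positivity)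
    have h2 : k i ≤ k i ^ 2 := Nat.le_self_pow two_ne_zero _
    have := hn i
    omega
  have htn : ∀ i, t < n i := fun i => by
    have h1 : 2 * (t + 1) ≤ 2 * (t + 1) * p * k i ^ 2 := by
      rw [mul_assoc]
      exact Nat.le_mul_of_pos_right _ (Nat.mul_pos hp (pow_pos (hk i) 2))
    have := hn i
    omega
  have hstar : ∀ T ⊆ groundSet X, T.card = t →
      (starOf (directProduct X k) T).card ≤ maxStarSize t n k := fun T hT hTt => by
    rw [← Nat.cast_le (α := ℚ), card_starOf_directProduct hdisj hcard hT]
    exact starWeight_le_maxStarSize ((sum_card_inter_part hdisj hT).trans hTt)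
  -- The exchange condition is a comparison of ratios of consecutive shifted binomials.
  have hratio : ∀ (T : Finset α) (j : Fin p), 1 ≤ (T ∩ X j).card →
      ((k j : ℚ) - (T ∩ X j).card + 1) / ((n j : ℚ) - (T ∩ X j).card + 1) =
        shiftRatio (n j) (k j) ((T ∩ X j).card - 1) := fun T j hj => by
    unfold shiftRatio
    rw [Nat.cast_sub hj]
    congr 1 <;> push_cast <;> ring
  refine ⟨?_, fun htk => ⟨fun heq => ?_, ?_⟩⟩
  · rcases 𝓕.eq_empty_or_nonempty with rfl | hne
    · simp
    rcases subset_star_or_card_lt hp hkn hn hdisj hcard hsub hint hne with ⟨T, hT, hTt, hF⟩ | h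
    · exact (card_le_card hF).trans (hstar T hT hTt)
    · exact h.le
  · have hne : 𝓕.Nonempty := card_pos.1 (heq ▸ maxStarSize_pos hkn htk)
    rcases subset_star_or_card_lt hp hkn hn hdisj hcard hsub hint hne with ⟨T, hT, hTt, hF⟩ | h
    · have h1 : (starOf (directProduct X k) T).card ≤ 𝓕.card := by
        rw [heq]
        exact hstar T hT hTt
      have hFeq := eq_of_subset_of_card_le hF h1
      refine ⟨T, hT, hTt, fun j hj i => ?_, hFeq⟩
      rw [hratio T j hj]
      refine shiftRatio_le_of_starWeight_eq_max (s := fun i => (T ∩ X i).card) hkn htn htk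
        ((sum_card_inter_part hdisj hT).trans hTt) ?_ hj i
      rw [← card_starOf_directProduct hdisj hcard hT, ← hFeq, heq]
    · exact absurd heq h.ne
  · rintro ⟨T, hT, hTt, hloc, hF⟩
    have h1 : starWeight n k (fun i => (T ∩ X i).card) = maxStarSize t n k := by
      refine starWeight_eq_max_of_shiftRatio_le ht hkn htn htk
        ((sum_card_inter_part hdisj hT).trans hTt) fun j hj i => ?_
      rw [← hratio T j hj]
      exact hloc j hj i
    rw [← card_starOf_directProduct hdisj hcard hT, starOf, ← hF] at h1
    exact_mod_cast h1
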